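/- Let $m \ge n \ge 3$. The squares of the $m\times n$ board are the pairs $(p,q)$ of integers with $0\le p\le m-1$ and $0\le q\le n-1$ (east is the direction of increasing $p$, north that of increasing $q$). Put $(p,q)E=(p+1,q)$ if $p<m-1$ and $(m-1,q)E=(0,n-1-q)$; put $(p,q)N=(p,q+1)$ if $q<n-1$ and $(p,n-1)N=(m-1-p,0)$. The $m\times n$ projective checkerboard is the digraph on these squares with a directed edge from $\sigma$ to $\sigma E$ and from $\sigma$ to $\sigma N$ for each square $\sigma$. A hamiltonian path $\mathcal H=[\iota](X_1X_2\cdots X_k)$, with each $X_i\in\{E,N\}$, is a walk $\iota,\ \iota X_1,\ \iota X_1X_2,\ \dots,\ \tau=\iota X_1\cdots X_k$ that visits each square exactly once; $\iota$ is its initial square and $\tau$ its terminal square. With $\widetilde{(p,q)}=(m-1-p,n-1-q)$, the inverse of $\mathcal H$ is the hamiltonian path $\widetilde{\mathcal H}=[\widetilde\tau](X_k\cdots X_2X_1)$, whose initial square is $\widetilde\tau$. Diagonals are the equivalence classes of the transitive closure of the relation $\{\sigma E,\sigma N\}\cap\{\sigma' E,\sigma' N\}\neq\emptyset$ on squares $\sigma,\sigma'$.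 Write $S_i=\{(p,q) : p+q=i\}$. A diagonal travels east in $\mathcal H$ if, for each of its squares $\sigma$, the edge from $\sigma$ to $\sigma E$ is in $\mathcal H$. **Proposition.** Let $\mathcal H$ be a hamiltonian path in the $m\times n$ projective checkerboard, where $m\ge n\ge 3$. Then the diagonal containing the terminal square of $\mathcal H$ is of the form $S_a\cup S_b$ with $a\le b$ and $a+b=m+n-3$. Let $\tau_+$ be the southeasternmost square of $S_b$, and call a diagonal $S_i\cup S_j$ with $i\le j$ and $i+j=m+n-3$ *inner* if $i>a$. Then at least one of the following holds: 1. the initial square of $\mathcal H$ or of $\widetilde{\mathcal H}$ is $\tau_+E$; 2. all inner diagonals travel east in $\mathcal H$, and the initial square of $\mathcal H$ or of $\widetilde{\mathcal H}$ is $(p,0)$ for some $p$ with $1\le p\le\lfloor (m+n)/2\rfloor-1$. -/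

import Mathlib

namespace ProjBoard

/-- The squares `(p, q)` of the `m × n` board, `0 ≤ p ≤ m - 1` (west to east) and
`0 ≤ q ≤ n - 1` (south to north). -/
abbrev Square (m n : ℕ) : Type := Fin m × Fin n

variable {m n : ℕ}

/-- `(p, q)E`; `Fin.rev q` is `n - 1 - q`. -/
def east (σ : Square m n) : Square m n :=
  if h : σ.1.val + 1 < m then (⟨σ.1.val + 1, h⟩, σ.2)
  else (⟨0, Nat.zero_lt_of_lt σ.1.isLt⟩, σ.2.rev)

/-- `(p, q)N`; `Fin.rev p` is `m - 1 - p`. -/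
def north (σ : Square m n) : Square m n :=
  if h : σ.2.val + 1 < n then (σ.1, ⟨σ.2.val + 1, h⟩)
  else (σ.1.rev, ⟨0, Nat.zero_lt_of_lt σ.2.isLt⟩)

/-- The inverse `(m - 1 - p, n - 1 - q)` of a square `(p, q)`. -/
def inv (σ : Square m n) : Square m n := (σ.1.rev, σ.2.rev)

/-- The two directions of travel. -/
inductive Dir : Type
  | E
  | N

/-- `σX` for a direction `X`. -/
def step (σ : Square m n) : Dir → Square m n
  | Dir.E => east σ
  | Dir.N => north σ

/-- The list of squares `σ, σX₁, σX₁X₂, …, σX₁X₂⋯Xₖ`. -/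
def visited (σ : Square m n) : List Dir → List (Square m n)
  | [] => [σ]
  | X :: Xs => σ :: visited (step σ X) Xs

/-- A walk `[ι](X₁X₂⋯Xₖ)` in the digraph whose vertices are the squares and whose directed edges
are `σ → σE` and `σ → σN`: it is given by its initial square and its list of directions. -/
structure Walk (m n : ℕ) where
  start : Square m n
  steps : List Dir

namespace Walk

/-- The squares visited by the walk, in order. -/
def squares (H : Walk m n) : List (Square m n) := visited H.start H.steps

/-- The terminal square of the walk. -/
def terminal (H : Walk m n) : Square m n := H.steps.foldl step H.start

/-- A hamiltonian path visits every square exactly once. -/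
def IsHamiltonianPath (H : Walk m n) : Prop :=
  H.squares.Nodup ∧ ∀ σ : Square m n, σ ∈ H.squares

/-- The inverse of `[ι](X₁X₂⋯Xₖ)` with terminal square `τ` is `[inv τ](Xₖ⋯X₂X₁)`. -/
def inverse (H : Walk m n) : Walk m n := ⟨inv H.terminal, H.steps.reverse⟩

/-- A set of squares travels east in `H` if, for each of its squares `σ`, the edge from `σ` to `σE`
is in `H`, i.e. `σ, σE` are consecutive squares of `H`. -/
def TravelsEast (H : Walk m n) (D : Set (Square m n)) : Prop :=
  ∀ σ ∈ D, [σ, east σ] <:+: H.squares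

end Walk

/-- The relation `{σE, σN} ∩ {τE, τN} ≠ ∅`. -/
def Related (σ τ : Square m n) : Prop :=
  (({east σ, north σ} : Set (Square m n)) ∩ {east τ, north τ}).Nonempty

/-- The (direction-forcing) diagonal of `σ`: its class under the transitive closure of the
symmetric, reflexive relation `Related`. -/
def diagonal (σ : Square m n) : Set (Square m n) := {τ | Relation.TransGen Related σ τ}

/-- The diagonal that contains the terminal square of `H`. -/
def Walk.terminalDiagonal (H : Walk m n) : Set (Square m n) := diagonal H.terminal

/-- The subdiagonal `S_i = {(p, q) | p + q = i}`. -/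
def subdiagonal (m n i : ℕ) : Set (Square m n) := {σ | σ.1.val + σ.2.val = i}

/-- `D` is an inner diagonal relative to a terminal diagonal `S_a ∪ S_b` (`a ≤ b`, `a + b = m + n - 3`):
it is a diagonal of the form `S_i ∪ S_j` with `i ≤ j`, `i + j = m + n - 3` and `a < i`. -/
def IsInnerDiagonal (a : ℕ) (D : Set (Square m n)) : Prop :=
  (∃ σ, D = diagonal σ) ∧
    ∃ i j : ℕ, i ≤ j ∧ i + j + 3 = m + n ∧ D = subdiagonal m n i ∪ subdiagonal m n j ∧ a < i

/-- `τ` is the southeasternmost square of `S`: it lies in `S`, and no square of `S` is farther east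
or farther south. -/
def IsSoutheasternmost (τ : Square m n) (S : Set (Square m n)) : Prop :=
  τ ∈ S ∧ ∀ σ ∈ S, σ.1 ≤ τ.1 ∧ τ.2 ≤ σ.2

end ProjBoard

/-! Coordinate sums are called ranks. A diagonal consists of the squares of rank `i` or `m + n - 3 -
i`, except that the northeastern corner is a class by itself. If a diagonal misses the terminal
square, counting successors shows that none of its successors is the initial square, and all its
squares travel the same way. Since `σ` and `inv (east σ)` share a diagonal, and likewise for north,
`inv` reverses every edge that starts off the terminal diagonal (`FreeEdge.inv`). So a path of such
edges that crosses the boundary retraces itself: from `σ` it reaches `inv σ` (`FreePath.to_inv`).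

If the terminal square were the northeastern corner, this symmetry would hold for all edges, and two
boundary crossings would force a cycle (`rank_terminal`). So the terminal diagonal is a pair `S_a ∪
S_b`. Let `P` and `B` be the southeastern and northwestern ends of `S_b`; their inverses are the
ends of `S_{a+1}`. Every path leaving `S_b` for `S_{b+1}` crosses the boundary. Hence, if the first
alternative fails, `P` precedes `inv P`; and if `inv B = (a + 1, 0)` is the initial square of
neither path, `B` precedes `inv B`.

Now follow the path through the inner diagonals. An inner diagonal travelling north would lead from
`inv P` back to `P`, or close a cycle by itself; so all travel east. From `inv P` and `inv B` either
one path crosses the boundary and returns to its own inverse, or the two arrive at `B` and `P`.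
Either way a cycle arises if both precedences hold, so `inv B` is one of the initial squares. -/

namespace ProjBoard

variable {m n : ℕ}

/-! ### Coordinates -/

/-- The number of the subdiagonal that contains a square. -/
def rank (σ : Square m n) : ℕ := σ.1.val + σ.2.val

theorem Square.ext_val {σ τ : Square m n} (h₁ : σ.1.val = τ.1.val) (h₂ : σ.2.val = τ.2.val) :
    σ = τ := Prod.ext (Fin.ext h₁) (Fin.ext h₂)

theorem inv_fst (σ : Square m n) : (inv σ).1.val = m - (σ.1.val + 1) := Fin.val_rev _

theorem inv_snd (σ : Square m n) : (inv σ).2.val = n - (σ.2.val + 1) := Fin.val_rev _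

@[simp] theorem inv_inv (σ : Square m n) : inv (inv σ) = σ := by
  simp [inv]

theorem inv_injective : Function.Injective (inv : Square m n → Square m n) :=
  Function.LeftInverse.injective inv_inv

theorem rank_inv (σ : Square m n) : rank (inv σ) + rank σ + 2 = m + n := by
  have h₁ := σ.1.isLt
  have h₂ := σ.2.isLt
  simp only [rank, inv_fst, inv_snd]
  omega

theorem east_of_lt {σ : Square m n} (h : σ.1.val + 1 < m) :
    (east σ).1.val = σ.1.val + 1 ∧ (east σ).2.val = σ.2.val := by
  simp [east, h]

theorem east_of_last {σ : Square m n} (h : ¬ σ.1.val + 1 < m) : east σ = inv σ := by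
  have h₁ := σ.1.isLt
  apply Square.ext_val
  · simp [east, h, inv_fst]
    omega
  · simp [east, h, inv]

theorem north_of_lt {σ : Square m n} (h : σ.2.val + 1 < n) :
    (north σ).1.val = σ.1.val ∧ (north σ).2.val = σ.2.val + 1 := by
  simp [north, h]

theorem north_of_last {σ : Square m n} (h : ¬ σ.2.val + 1 < n) : north σ = inv σ := by
  have h₂ := σ.2.isLt
  apply Square.ext_val
  · simp [north, h, inv]
  · simp [north, h, inv_snd]
    omega

theorem east_inv_east (σ : Square m n) : east (inv (east σ)) = inv σ := by
  have h₁ := σ.1.isLt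
  by_cases h : σ.1.val + 1 < m
  · obtain ⟨e₁, e₂⟩ := east_of_lt h
    have h' : (inv (east σ)).1.val + 1 < m := by
      rw [inv_fst]
      omega
    obtain ⟨f₁, f₂⟩ := east_of_lt h'
    apply Square.ext_val
    · rw [f₁, inv_fst, inv_fst]
      omega
    · rw [f₂, inv_snd, inv_snd, e₂]
  · rw [east_of_last h, inv_inv, east_of_last h]

theorem north_inv_north (σ : Square m n) : north (inv (north σ)) = inv σ := by
  have h₂ := σ.2.isLt
  by_cases h : σ.2.val + 1 < n
  · obtain ⟨e₁, e₂⟩ := north_of_lt h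
    have h' : (inv (north σ)).2.val + 1 < n := by
      rw [inv_snd]
      omega
    obtain ⟨f₁, f₂⟩ := north_of_lt h'
    apply Square.ext_val
    · rw [f₁, inv_fst, inv_fst, e₁]
    · rw [f₂, inv_snd, inv_snd]
      omega
  · rw [north_of_last h, inv_inv, north_of_last h]

theorem east_injective : Function.Injective (east : Square m n → Square m n) := by
  intro σ τ h
  apply inv_injective
  rw [← east_inv_east σ, h, east_inv_east]

theorem north_injective : Function.Injective (north : Square m n → Square m n) := by
  intro σ τ h
  apply inv_injective
  rw [← north_inv_north σ, h, north_inv_north]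

theorem east_surjective : Function.Surjective (east : Square m n → Square m n) :=
  Finite.surjective_of_injective east_injective

/-! ### Diagonals -/

/-- Two squares have the same rank, or ranks whose sum is `m + n - 3`. -/
def SameClass (σ τ : Square m n) : Prop :=
  rank τ = rank σ ∨ rank τ + rank σ + 3 = m + n

theorem SameClass.trans {σ τ υ : Square m n} (h : SameClass σ τ) (h' : SameClass τ υ) :
    SameClass σ υ := by
  unfold SameClass at *
  omega

theorem SameClass.symm {σ τ : Square m n} (h : SameClass σ τ) : SameClass τ σ := by
  unfold SameClass at *
  omega

theorem sameClass_inv_east (σ : Square m n) : SameClass σ (inv (east σ)) := by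
  by_cases h : σ.1.val + 1 < m
  · have := rank_inv (east σ)
    obtain ⟨e₁, e₂⟩ := east_of_lt h
    unfold SameClass rank at *
    omega
  · rw [east_of_last h, inv_inv]
    exact Or.inl rfl

theorem sameClass_inv_north (σ : Square m n) : SameClass σ (inv (north σ)) := by
  by_cases h : σ.2.val + 1 < n
  · have := rank_inv (north σ)
    obtain ⟨e₁, e₂⟩ := north_of_lt h
    unfold SameClass rank at *
    omega
  · rw [north_of_last h, inv_inv]
    exact Or.inl rfl

theorem related_iff {σ τ : Square m n} :
    Related σ τ ↔ σ = τ ∨ east σ = north τ ∨ north σ = east τ := by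
  constructor
  · rintro ⟨x, hx, hy⟩
    simp only [Set.mem_insert_iff, Set.mem_singleton_iff] at hx hy
    rcases hx with rfl | rfl <;> rcases hy with hy | hy
    · exact Or.inl (east_injective hy)
    · exact Or.inr (Or.inl hy)
    · exact Or.inr (Or.inr hy)
    · exact Or.inl (north_injective hy)
  · rintro (rfl | h | h)
    · exact ⟨east σ, by simp⟩
    · exact ⟨east σ, by simp [h]⟩
    · exact ⟨north σ, by simp [h]⟩

theorem Related.symm {σ τ : Square m n} (h : Related σ τ) : Related τ σ := by
  rw [related_iff] at *
  rcases h with h | h | h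
  · exact Or.inl h.symm
  · exact Or.inr (Or.inr h.symm)
  · exact Or.inr (Or.inl h.symm)

theorem related_of_east_eq_north {σ τ : Square m n} (h : east σ = north τ) : Related σ τ :=
  related_iff.2 (Or.inr (Or.inl h))

theorem Related.sameClass {σ τ : Square m n} (h : Related σ τ) : SameClass σ τ := by
  rcases related_iff.1 h with rfl | h | h
  · exact Or.inl rfl
  · have h' := sameClass_inv_east σ
    rw [h] at h'
    exact h'.trans (sameClass_inv_north τ).symm
  · have h' := sameClass_inv_north σ
    rw [h] at h'
    exact h'.trans (sameClass_inv_east τ).symm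

theorem sameClass_of_mem_diagonal {σ τ : Square m n} (h : τ ∈ diagonal σ) : SameClass σ τ := by
  change Relation.TransGen Related σ τ at h
  induction h with
  | single h => exact h.sameClass
  | tail _ h ih => exact ih.trans h.sameClass

theorem mem_diagonal_symm {σ τ : Square m n} (h : τ ∈ diagonal σ) : σ ∈ diagonal τ := by
  have : Std.Symm (Related : Square m n → Square m n → Prop) := ⟨fun _ _ => Related.symm⟩
  exact Relation.TransGen.stdSymm.symm _ _ h

theorem mem_diagonal_self (σ : Square m n) : σ ∈ diagonal σ :=
  Relation.TransGen.single (related_iff.2 (Or.inl rfl))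

theorem mem_diagonal_trans {σ τ υ : Square m n} (h : τ ∈ diagonal σ) (h' : υ ∈ diagonal τ) :
    υ ∈ diagonal σ := Relation.TransGen.trans h h'

theorem mem_diagonal_of_east_eq_north {σ τ : Square m n} (h : east σ = north τ) :
    τ ∈ diagonal σ := Relation.TransGen.single (related_of_east_eq_north h)

/-- A square of low rank is on the diagonal of the square of the same rank in the southern row. -/
theorem mem_diagonal_south {i : ℕ} {α : Square m n} (hα : α.1.val = i) (hα' : α.2.val = 0)
    (σ : Square m n) (hσ : rank σ = i) : α ∈ diagonal σ := by
  obtain ⟨k, hk⟩ : ∃ k, σ.2.val = k := ⟨_, rfl⟩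
  induction k generalizing σ with
  | zero =>
    have : σ = α := by
      unfold rank at hσ
      apply Square.ext_val <;> omega
    rw [this]
    exact mem_diagonal_self _
  | succ k ih =>
    have h₁ := α.1.isLt
    have h₂ := σ.2.isLt
    unfold rank at *
    have hE : σ.1.val + 1 < m := by omega
    let τ : Square m n := (⟨σ.1.val + 1, hE⟩, ⟨k, by omega⟩)
    have hN : τ.2.val + 1 < n := by
      change k + 1 < n
      omega
    refine mem_diagonal_trans (mem_diagonal_of_east_eq_north (τ := τ) ?_) (ih τ ?_ rfl)
    · obtain ⟨e₁, e₂⟩ := east_of_lt hE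
      obtain ⟨f₁, f₂⟩ := north_of_lt hN
      apply Square.ext_val
      · rw [e₁, f₁]
      · rw [e₂, f₂, hk]
    · change σ.1.val + 1 + k = i
      omega

/-- A square of high rank is on the diagonal of the square of the same rank in the northern row. -/
theorem mem_diagonal_north {j : ℕ} {β : Square m n} (hβ : β.1.val + β.2.val = j)
    (hβ' : β.2.val + 1 = n) (σ : Square m n) (hσ : rank σ = j) : β ∈ diagonal σ := by
  obtain ⟨k, hk⟩ : ∃ k, n - 1 - σ.2.val = k := ⟨_, rfl⟩
  induction k generalizing σ with
  | zero =>
    have : σ = β := by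
      have := σ.2.isLt
      unfold rank at hσ
      apply Square.ext_val <;> omega
    rw [this]
    exact mem_diagonal_self _
  | succ k ih =>
    have h₁ := σ.1.isLt
    have h₂ := σ.2.isLt
    unfold rank at *
    have hN : σ.2.val + 1 < n := by omega
    let τ : Square m n := (⟨σ.1.val - 1, by omega⟩, ⟨σ.2.val + 1, hN⟩)
    have hE : τ.1.val + 1 < m := by
      change σ.1.val - 1 + 1 < m
      omega
    have h₃ : τ.1.val = σ.1.val - 1 := rfl
    have h₄ : τ.2.val = σ.2.val + 1 := rfl
    refine mem_diagonal_trans (mem_diagonal_symm (mem_diagonal_of_east_eq_north (σ := τ) ?_))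
      (ih τ ?_ ?_)
    · obtain ⟨e₁, e₂⟩ := east_of_lt hE
      obtain ⟨f₁, f₂⟩ := north_of_lt hN
      apply Square.ext_val <;> omega
    · omega
    · omega

/-- The two subdiagonals are linked across the northern edge: the southern end `α` of the lower one
and the northern end `β` of the upper one satisfy `east α = north β`. -/
theorem mem_diagonal_of_rank (hn : 2 ≤ n) (hmn : n ≤ m) {σ τ : Square m n}
    (h : rank σ ≤ rank τ) (h' : rank τ + rank σ + 3 = m + n) : τ ∈ diagonal σ := by
  have hi : rank σ + 2 ≤ m := by omega
  let α : Square m n := (⟨rank σ, by omega⟩, ⟨0, by omega⟩)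
  let β : Square m n := (⟨m - 2 - rank σ, by omega⟩, ⟨n - 1, by omega⟩)
  have hβ₁ : β.1.val = m - 2 - rank σ := rfl
  have hβ₂ : β.2.val = n - 1 := rfl
  have h₁ : α ∈ diagonal σ := mem_diagonal_south rfl rfl σ rfl
  have h₂ : β ∈ diagonal τ := mem_diagonal_north rfl (by omega) τ (by omega)
  refine mem_diagonal_trans h₁ (mem_diagonal_trans (mem_diagonal_of_east_eq_north (τ := β) ?_)
    (mem_diagonal_symm h₂))
  have hE : α.1.val + 1 < m := by
    change rank σ + 1 < m
    omega
  obtain ⟨e₁, e₂⟩ := east_of_lt hE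
  have hN : north β = inv β := north_of_last (by omega)
  rw [hN]
  apply Square.ext_val
  · rw [e₁, inv_fst, hβ₁]
    change rank σ + 1 = _
    omega
  · rw [e₂, inv_snd, hβ₂]
    change 0 = _
    omega

theorem mem_diagonal_of_rank_eq (hmn : n ≤ m) {σ τ : Square m n}
    (h : rank σ = rank τ) : τ ∈ diagonal σ := by
  by_cases hm : rank σ < m
  · have := σ.2.isLt
    let α : Square m n := (⟨rank σ, hm⟩, ⟨0, by omega⟩)
    exact mem_diagonal_trans (mem_diagonal_south (α := α) rfl rfl σ rfl)
      (mem_diagonal_symm (mem_diagonal_south (α := α) rfl rfl τ h.symm))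
  · have := σ.2.isLt
    have := σ.1.isLt
    have hr : rank σ = σ.1.val + σ.2.val := rfl
    let β : Square m n := (⟨rank σ - (n - 1), by omega⟩, ⟨n - 1, by omega⟩)
    have hβ₁ : β.1.val = rank σ - (n - 1) := rfl
    have hβ₂ : β.2.val = n - 1 := rfl
    exact mem_diagonal_trans (mem_diagonal_north (β := β) rfl (by omega) σ (by omega))
      (mem_diagonal_symm (mem_diagonal_north (β := β) rfl (by omega) τ (by omega)))

theorem mem_diagonal_iff (hn : 2 ≤ n) (hmn : n ≤ m) {σ τ : Square m n} :
    τ ∈ diagonal σ ↔ SameClass σ τ := by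
  refine ⟨sameClass_of_mem_diagonal, ?_⟩
  rintro (h | h)
  · exact mem_diagonal_of_rank_eq hmn h.symm
  · rcases le_total (rank σ) (rank τ) with h' | h'
    · exact mem_diagonal_of_rank hn hmn h' h
    · exact mem_diagonal_symm (mem_diagonal_of_rank hn hmn h' (by omega))

/-! ### Lists without repetition -/

theorem idxOf_of_pair_infix {α : Type*} [BEq α] [LawfulBEq α] {l : List α} (hl : l.Nodup) {x y : α}
    (h : [x, y] <:+: l) : l.idxOf y = l.idxOf x + 1 := by
  obtain ⟨s, t, rfl⟩ := h
  have h₁ : x ∉ s := by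
    intro hx
    simp [List.nodup_append] at hl
    exact (hl.2.2 x hx).1 rfl
  have h₂ : y ∉ s := by
    intro hy
    simp [List.nodup_append] at hl
    exact (hl.2.2 y hy).2.1 rfl
  have h₃ : x ≠ y := by
    rintro rfl
    simp [List.nodup_append] at hl
  rw [List.append_assoc, List.idxOf_append_of_notMem h₁, List.idxOf_append_of_notMem h₂]
  simp [h₃]

theorem pair_infix_getElem {α : Type*} (l : List α) (k : ℕ) (hk : k + 1 < l.length) :
    [l[k], l[k + 1]] <:+: l := by
  refine ⟨l.take k, l.drop (k + 2), ?_⟩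
  conv_rhs => rw [← List.take_append_drop k l, List.drop_eq_getElem_cons (by omega),
    List.drop_eq_getElem_cons hk]
  simp

theorem transGen_of_idxOf_lt {α : Type*} [BEq α] [LawfulBEq α] {l : List α} {x y : α}
    (hy : y ∈ l) (h : l.idxOf x < l.idxOf y) :
    Relation.TransGen (fun u v => [u, v] <:+: l) x y := by
  have key : ∀ d k (hk : k + d + 1 < l.length),
      Relation.TransGen (fun u v => [u, v] <:+: l) (l[k]) (l[k + d + 1]) := by
    intro d
    induction d with
    | zero => exact fun k hk => Relation.TransGen.single (pair_infix_getElem l k hk)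
    | succ d ih =>
      exact fun k hk => (ih k (by omega)).tail (pair_infix_getElem l (k + d + 1) hk)
  have hy' := List.idxOf_lt_length_of_mem hy
  obtain ⟨d, hd⟩ := Nat.exists_eq_add_of_lt h
  have := key d (l.idxOf x) (by omega)
  simpa [← hd] using this

open Relation

/-! ### The edges of a hamiltonian path -/

theorem visited_eq_cons (σ : Square m n) (L : List Dir) : ∃ t, visited σ L = σ :: t := by
  cases L with
  | nil => exact ⟨_, rfl⟩
  | cons X L => exact ⟨_, rfl⟩

theorem visited_edge {σ τ : Square m n} {L : List Dir} {s : Square m n}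
    (h : [σ, τ] <:+: visited s L) : τ = east σ ∨ τ = north σ := by
  induction L generalizing s with
  | nil =>
    have := h.length_le
    simp [visited] at this
  | cons X L ih =>
    rw [visited, List.infix_cons_iff] at h
    rcases h with h | h
    · obtain ⟨t, ht⟩ := visited_eq_cons (step s X) L
      rw [ht] at h
      simp only [List.cons_prefix_cons] at h
      obtain ⟨rfl, rfl, -⟩ := h
      cases X
      · exact Or.inl rfl
      · exact Or.inr rfl
    · exact ih h

theorem visited_exists_succ {σ : Square m n} {L : List Dir} {s : Square m n}
    (h : σ ∈ visited s L) (hσ : σ ≠ L.foldl step s) : ∃ τ, [σ, τ] <:+: visited s L := by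
  induction L generalizing s with
  | nil =>
    simp [visited] at h
    exact absurd h hσ
  | cons X L ih =>
    rw [visited, List.mem_cons] at h
    rcases h with rfl | h
    · obtain ⟨t, ht⟩ := visited_eq_cons (step σ X) L
      refine ⟨step σ X, ?_⟩
      rw [visited, ht]
      exact (List.prefix_append [σ, step σ X] t).isInfix
    · obtain ⟨τ, hτ⟩ := ih h hσ
      exact ⟨τ, List.infix_cons_iff.2 (Or.inr hτ)⟩

theorem visited_exists_pred {σ : Square m n} {L : List Dir} {s : Square m n}
    (h : σ ∈ visited s L) (hσ : σ ≠ s) : ∃ τ, [τ, σ] <:+: visited s L := by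
  induction L generalizing s with
  | nil =>
    simp [visited] at h
    exact absurd h hσ
  | cons X L ih =>
    rw [visited, List.mem_cons] at h
    rcases h with rfl | h
    · exact absurd rfl hσ
    · by_cases h' : σ = step s X
      · subst h'
        obtain ⟨t, ht⟩ := visited_eq_cons (step s X) L
        refine ⟨s, ?_⟩
        rw [visited, ht]
        exact (List.prefix_append [s, step s X] t).isInfix
      · obtain ⟨τ, hτ⟩ := ih h h'
        exact ⟨τ, List.infix_cons_iff.2 (Or.inr hτ)⟩

theorem terminal_mem_visited (L : List Dir) (s : Square m n) : L.foldl step s ∈ visited s L := by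
  induction L generalizing s with
  | nil => simp [visited]
  | cons X L ih => exact List.mem_cons_of_mem _ (ih _)

theorem visited_not_edge_terminal {L : List Dir} {s τ : Square m n} (hL : (visited s L).Nodup) :
    ¬ [L.foldl step s, τ] <:+: visited s L := by
  induction L generalizing s with
  | nil =>
    intro h
    have := h.length_le
    simp [visited] at this
  | cons X L ih =>
    intro h
    rw [visited, List.nodup_cons] at hL
    rw [visited, List.infix_cons_iff] at h
    rcases h with h | h
    · obtain ⟨h, -⟩ := List.cons_prefix_cons.1 h
      have h' := terminal_mem_visited L (step s X)
      rw [show L.foldl step (step s X) = s from h] at h'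
      exact hL.1 h'
    · exact ih hL.2 h

namespace Walk

variable {H : Walk m n}

/-- `σ, τ` are consecutive squares of the walk. -/
def Edge (H : Walk m n) (σ τ : Square m n) : Prop := [σ, τ] <:+: H.squares

theorem Edge.eq_step {σ τ : Square m n} (h : H.Edge σ τ) : τ = east σ ∨ τ = north σ :=
  visited_edge h

theorem Edge.start_ne {σ τ : Square m n} (hH : H.IsHamiltonianPath) (h : H.Edge σ τ) :
    τ ≠ H.start := by
  rintro rfl
  have h' := idxOf_of_pair_infix hH.1 h
  obtain ⟨t, ht⟩ := visited_eq_cons H.start H.steps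
  rw [squares, ht] at h'
  simp at h'

theorem Edge.ne_terminal {σ τ : Square m n} (hH : H.IsHamiltonianPath) (h : H.Edge σ τ) :
    σ ≠ H.terminal := by
  rintro rfl
  exact visited_not_edge_terminal hH.1 h

theorem Edge.left_unique (hH : H.IsHamiltonianPath) {σ σ' τ : Square m n} (h : H.Edge σ τ)
    (h' : H.Edge σ' τ) : σ = σ' := by
  have h₁ := idxOf_of_pair_infix hH.1 h
  have h₂ := idxOf_of_pair_infix hH.1 h'
  exact (List.idxOf_inj (hH.2 σ)).1 (by omega)

theorem Edge.right_unique (hH : H.IsHamiltonianPath) {σ τ τ' : Square m n} (h : H.Edge σ τ)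
    (h' : H.Edge σ τ') : τ = τ' := by
  have h₁ := idxOf_of_pair_infix hH.1 h
  have h₂ := idxOf_of_pair_infix hH.1 h'
  exact (List.idxOf_inj (hH.2 τ)).1 (by omega)

namespace IsHamiltonianPath

theorem exists_succ (hH : H.IsHamiltonianPath) {σ : Square m n} (h : σ ≠ H.terminal) :
    H.Edge σ (east σ) ∨ H.Edge σ (north σ) := by
  obtain ⟨τ, hτ⟩ := visited_exists_succ (hH.2 σ) h
  rcases visited_edge hτ with rfl | rfl
  · exact Or.inl hτ
  · exact Or.inr hτ

theorem exists_pred (hH : H.IsHamiltonianPath) {τ : Square m n} (h : τ ≠ H.start) :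
    ∃ σ, H.Edge σ τ := visited_exists_pred (hH.2 τ) h

theorem acyclic (hH : H.IsHamiltonianPath) {σ : Square m n} : ¬ TransGen H.Edge σ σ := by
  have key : ∀ {σ τ}, TransGen H.Edge σ τ → H.squares.idxOf σ < H.squares.idxOf τ := by
    intro σ τ h
    induction h with
    | single h =>
      have := idxOf_of_pair_infix hH.1 h
      omega
    | tail _ h ih =>
      have := idxOf_of_pair_infix hH.1 h
      omega
  exact fun h => lt_irrefl _ (key h)

theorem transGen_or (hH : H.IsHamiltonianPath) {σ τ : Square m n} (h : σ ≠ τ) :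
    TransGen H.Edge σ τ ∨ TransGen H.Edge τ σ := by
  rcases lt_trichotomy (H.squares.idxOf σ) (H.squares.idxOf τ) with h' | h' | h'
  · exact Or.inl (transGen_of_idxOf_lt (hH.2 _) h')
  · exact absurd ((List.idxOf_inj (hH.2 σ)).1 h') h
  · exact Or.inr (transGen_of_idxOf_lt (hH.2 _) h')

/-- The square between two related squares, if it is not the initial square, is entered from one
of them. -/
theorem pred_of_east_eq_north (hH : H.IsHamiltonianPath) {σ τ : Square m n}
    (h : east σ = north τ) (hs : east σ ≠ H.start) : H.Edge σ (east σ) ∨ H.Edge τ (east σ) := by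
  obtain ⟨υ, hυ⟩ := hH.exists_pred hs
  rcases hυ.eq_step with h' | h'
  · rw [← east_injective h'] at hυ
    exact Or.inl hυ
  · rw [← north_injective (h.symm.trans h')] at hυ
    exact Or.inr hυ

/-! ### Diagonals without the terminal square -/

theorem ne_terminal_of_notMem {σ : Square m n} (hσ : σ ∉ H.terminalDiagonal) :
    σ ≠ H.terminal := by
  rintro rfl
  exact hσ (mem_diagonal_self _)

theorem notMem_terminalDiagonal_of_mem {σ τ : Square m n} (hσ : σ ∉ H.terminalDiagonal)
    (h : τ ∈ diagonal σ) : τ ∉ H.terminalDiagonal :=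
  fun hτ => hσ (mem_diagonal_trans hτ (mem_diagonal_symm h))

/-- A count: on the diagonal `D` of `σ` every square has a successor. These successors are distinct
and lie in `east '' D`, which also contains `north '' D`. So they exhaust `east '' D`, and each of
its squares has a predecessor. -/
theorem start_ne_east (hH : H.IsHamiltonianPath) {σ : Square m n}
    (hσ : σ ∉ H.terminalDiagonal) : east σ ≠ H.start := by
  classical
  have hs : ∀ δ : Square m n, ∃ τ, δ ∈ diagonal σ → H.Edge δ τ := by
    intro δ
    by_cases hδ : δ ∈ diagonal σ
    · have := ne_terminal_of_notMem (notMem_terminalDiagonal_of_mem hσ hδ)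
      rcases hH.exists_succ this with h | h
      · exact ⟨_, fun _ => h⟩
      · exact ⟨_, fun _ => h⟩
    · exact ⟨σ, fun h => absurd h hδ⟩
  choose s hs using hs
  let D : Finset (Square m n) := Finset.univ.filter (· ∈ diagonal σ)
  have hD : ∀ {δ}, δ ∈ D ↔ δ ∈ diagonal σ := by simp [D]
  have hsub : D.image s ⊆ D.image east := by
    intro x hx
    obtain ⟨δ, hδ, rfl⟩ := Finset.mem_image.1 hx
    rcases (hs δ (hD.1 hδ)).eq_step with h | h
    · rw [h]
      exact Finset.mem_image_of_mem _ hδ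
    · obtain ⟨ε, hε⟩ := east_surjective (north δ)
      refine Finset.mem_image.2 ⟨ε, hD.2 (mem_diagonal_trans (hD.1 hδ) ?_), hε.trans h.symm⟩
      exact mem_diagonal_symm (mem_diagonal_of_east_eq_north hε)
  have hcard : (D.image east).card ≤ (D.image s).card := by
    rw [Finset.card_image_of_injective _ east_injective, Finset.card_image_of_injOn]
    intro x hx y hy hxy
    have h₁ := hs x (hD.1 hx)
    have h₂ := hs y (hD.1 hy)
    rw [hxy] at h₁
    exact h₁.left_unique hH h₂
  have heq := Finset.eq_of_subset_of_card_le hsub hcard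
  have hmem : east σ ∈ D.image s := by
    rw [heq]
    exact Finset.mem_image_of_mem _ (hD.2 (mem_diagonal_self σ))
  obtain ⟨δ, hδ, hδ'⟩ := Finset.mem_image.1 hmem
  rw [← hδ']
  exact (hs δ (hD.1 hδ)).start_ne hH

/-- The common successor is entered from exactly one of two distinct squares: if `σ` goes east into
it, `τ` cannot go north, and conversely. -/
theorem edge_iff_of_east_eq_north (hH : H.IsHamiltonianPath) {σ τ : Square m n}
    (hσ : σ ∉ H.terminalDiagonal) (h : east σ = north τ) :
    (H.Edge σ (east σ) ↔ H.Edge τ (east τ)) ∧ (H.Edge σ (north σ) ↔ H.Edge τ (north τ)) := by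
  by_cases hne : σ = τ
  · subst hne
    exact ⟨Iff.rfl, Iff.rfl⟩
  have hτ := notMem_terminalDiagonal_of_mem hσ (mem_diagonal_of_east_eq_north h)
  have h₁ := hH.exists_succ (ne_terminal_of_notMem hσ)
  have h₂ := hH.exists_succ (ne_terminal_of_notMem hτ)
  have h₃ := hH.pred_of_east_eq_north h (hH.start_ne_east hσ)
  have h₄ : ¬ (H.Edge σ (east σ) ∧ H.Edge τ (east σ)) := fun h' => hne (h'.1.left_unique hH h'.2)
  have h₅ : ¬ (H.Edge σ (east σ) ∧ H.Edge σ (north σ)) := fun h' =>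
    hne (north_injective ((h'.1.right_unique hH h'.2).symm.trans h))
  have h₆ : ¬ (H.Edge τ (east τ) ∧ H.Edge τ (east σ)) := fun h' =>
    hne (east_injective (h'.1.right_unique hH h'.2).symm)
  rw [← h] at *
  tauto

theorem edge_iff_of_related (hH : H.IsHamiltonianPath) {σ τ : Square m n}
    (hσ : σ ∉ H.terminalDiagonal) (h : Related σ τ) :
    (H.Edge σ (east σ) ↔ H.Edge τ (east τ)) ∧ (H.Edge σ (north σ) ↔ H.Edge τ (north τ)) := by
  rcases related_iff.1 h with rfl | h' | h'
  · exact ⟨Iff.rfl, Iff.rfl⟩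
  · exact hH.edge_iff_of_east_eq_north hσ h'
  · have hτ := notMem_terminalDiagonal_of_mem hσ (TransGen.single h)
    have := hH.edge_iff_of_east_eq_north hτ h'.symm
    exact ⟨this.1.symm, this.2.symm⟩

/-- A diagonal that does not contain the terminal square travels in a single direction. -/
theorem edge_iff_of_mem_diagonal (hH : H.IsHamiltonianPath) {σ τ : Square m n}
    (hσ : σ ∉ H.terminalDiagonal) (h : τ ∈ diagonal σ) :
    (H.Edge σ (east σ) ↔ H.Edge τ (east τ)) ∧ (H.Edge σ (north σ) ↔ H.Edge τ (north τ)) := by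
  change TransGen Related σ τ at h
  induction h with
  | single h => exact hH.edge_iff_of_related hσ h
  | tail h h' ih =>
    have := hH.edge_iff_of_related (notMem_terminalDiagonal_of_mem hσ h) h'
    exact ⟨ih.1.trans this.1, ih.2.trans this.2⟩

end IsHamiltonianPath

/-! ### Reversal of the part of a hamiltonian path off the terminal diagonal -/

/-- An edge of the walk that starts off the terminal diagonal. -/
def FreeEdge (H : Walk m n) (σ τ : Square m n) : Prop := H.Edge σ τ ∧ σ ∉ H.terminalDiagonal

/-- The reversed edge has the same direction and starts on the same diagonal, which travels in one
direction. -/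
theorem FreeEdge.inv (hn : 2 ≤ n) (hmn : n ≤ m) (hH : H.IsHamiltonianPath) {σ τ : Square m n}
    (h : H.FreeEdge σ τ) : H.FreeEdge (inv τ) (inv σ) := by
  obtain ⟨h, hσ⟩ := h
  rcases h.eq_step with rfl | rfl
  · have hmem := (mem_diagonal_iff hn hmn).2 (sameClass_inv_east σ)
    have := (hH.edge_iff_of_mem_diagonal hσ hmem).1.1 h
    rw [east_inv_east] at this
    exact ⟨this, IsHamiltonianPath.notMem_terminalDiagonal_of_mem hσ hmem⟩
  · have hmem := (mem_diagonal_iff hn hmn).2 (sameClass_inv_north σ)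
    have := (hH.edge_iff_of_mem_diagonal hσ hmem).2.1 h
    rw [north_inv_north] at this
    exact ⟨this, IsHamiltonianPath.notMem_terminalDiagonal_of_mem hσ hmem⟩

/-- `τ` is reached from `σ` along the walk by edges that start off the terminal diagonal. -/
def FreePath (H : Walk m n) : Square m n → Square m n → Prop := ReflTransGen H.FreeEdge

theorem FreePath.inv (hn : 2 ≤ n) (hmn : n ≤ m) (hH : H.IsHamiltonianPath) {σ τ : Square m n}
    (h : H.FreePath σ τ) : H.FreePath (inv τ) (inv σ) := by
  induction h with
  | refl => exact ReflTransGen.refl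
  | tail _ h ih => exact ReflTransGen.head (h.inv hn hmn hH) ih

theorem FreePath.reflTransGen {σ τ : Square m n} (h : H.FreePath σ τ) :
    ReflTransGen H.Edge σ τ := ReflTransGen.mono (fun _ _ h => h.1) _ _ h

/-- A path that crosses the boundary of the board continues as its own reversal. -/
theorem FreePath.to_inv (hn : 2 ≤ n) (hmn : n ≤ m) (hH : H.IsHamiltonianPath) {σ τ : Square m n}
    (h : H.FreePath σ τ) (h' : H.FreeEdge τ (ProjBoard.inv τ)) :
    H.FreePath σ (ProjBoard.inv σ) :=
  h.trans (ReflTransGen.head h' (h.inv hn hmn hH))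

/-- Paths that start at two squares of the same rank: one of them crosses the boundary, or both
travel by the same translation. -/
theorem IsHamiltonianPath.run (hn : 2 ≤ n) (hmn : n ≤ m) (hH : H.IsHamiltonianPath)
    {σ τ : Square m n} (hr : rank σ = rank τ) (d : ℕ)
    (hfree : ∀ υ : Square m n, rank σ ≤ rank υ → rank υ < rank σ + d →
      υ ∉ H.terminalDiagonal) :
    H.FreePath σ (inv σ) ∨ H.FreePath τ (inv τ) ∨
      ∃ e v : ℕ, e + v = d ∧ ∃ σ' τ' : Square m n, H.FreePath σ σ' ∧ H.FreePath τ τ' ∧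
        σ'.1.val = σ.1.val + e ∧ σ'.2.val = σ.2.val + v ∧
        τ'.1.val = τ.1.val + e ∧ τ'.2.val = τ.2.val + v := by
  induction d with
  | zero =>
    exact Or.inr (Or.inr ⟨0, 0, rfl, σ, τ, ReflTransGen.refl, ReflTransGen.refl, rfl, rfl, rfl, rfl⟩)
  | succ d ih =>
    rcases ih (fun υ h₁ h₂ => hfree υ h₁ (by omega)) with h | h | h
    · exact Or.inl h
    · exact Or.inr (Or.inl h)
    obtain ⟨e, v, hd, σ', τ', hσ, hτ, h₁, h₂, h₃, h₄⟩ := h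
    have hσ' : σ' ∉ H.terminalDiagonal := by
      apply hfree <;> unfold rank <;> omega
    have hτ' : τ' ∉ H.terminalDiagonal := by
      apply hfree <;> unfold rank at * <;> omega
    have hmem : τ' ∈ diagonal σ' := mem_diagonal_of_rank_eq hmn (by unfold rank at *; omega)
    rcases hH.exists_succ (IsHamiltonianPath.ne_terminal_of_notMem hσ') with hE | hE
    · have hE' := (hH.edge_iff_of_mem_diagonal hσ' hmem).1.1 hE
      by_cases hc : σ'.1.val + 1 < m
      · by_cases hc' : τ'.1.val + 1 < m
        · obtain ⟨f₁, f₂⟩ := east_of_lt hc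
          obtain ⟨g₁, g₂⟩ := east_of_lt hc'
          exact Or.inr (Or.inr ⟨e + 1, v, by omega, east σ', east τ', hσ.tail ⟨hE, hσ'⟩,
            hτ.tail ⟨hE', hτ'⟩, by omega, by omega, by omega, by omega⟩)
        · rw [east_of_last hc'] at hE'
          exact Or.inr (Or.inl (hτ.to_inv hn hmn hH ⟨hE', hτ'⟩))
      · rw [east_of_last hc] at hE
        exact Or.inl (hσ.to_inv hn hmn hH ⟨hE, hσ'⟩)
    · have hE' := (hH.edge_iff_of_mem_diagonal hσ' hmem).2.1 hE
      by_cases hc : σ'.2.val + 1 < n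
      · by_cases hc' : τ'.2.val + 1 < n
        · obtain ⟨f₁, f₂⟩ := north_of_lt hc
          obtain ⟨g₁, g₂⟩ := north_of_lt hc'
          exact Or.inr (Or.inr ⟨e, v + 1, by omega, north σ', north τ', hσ.tail ⟨hE, hσ'⟩,
            hτ.tail ⟨hE', hτ'⟩, by omega, by omega, by omega, by omega⟩)
        · rw [north_of_last hc'] at hE'
          exact Or.inr (Or.inl (hτ.to_inv hn hmn hH ⟨hE', hτ'⟩))
      · rw [north_of_last hc] at hE
        exact Or.inl (hσ.to_inv hn hmn hH ⟨hE, hσ'⟩)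

/-! ### The terminal square is not the northeastern corner -/

/-- Whichever way the diagonal travels, one of the two ends of the subdiagonal leaves the board: the
eastern one if it travels east, the northern one if north. -/
theorem exists_edge_inv {σ τ : Square m n} (hmn : n ≤ m)
    (hH : H.IsHamiltonianPath) (hr : rank σ = rank τ) (hσ : σ ∉ H.terminalDiagonal)
    (hσ' : σ.1.val + 1 = m) (hτ' : τ.2.val + 1 = n) :
    ∃ υ, rank υ = rank σ ∧ H.Edge υ (ProjBoard.inv υ) := by
  rcases hH.exists_succ (IsHamiltonianPath.ne_terminal_of_notMem hσ) with h | h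
  · rw [east_of_last (by omega)] at h
    exact ⟨σ, rfl, h⟩
  · have := (hH.edge_iff_of_mem_diagonal hσ (mem_diagonal_of_rank_eq hmn hr)).2.1 h
    rw [north_of_last (by omega)] at this
    exact ⟨τ, hr.symm, this⟩

theorem IsHamiltonianPath.rank_terminal (hn : 3 ≤ n) (hmn : n ≤ m) (hH : H.IsHamiltonianPath) :
    rank H.terminal + 3 ≤ m + n := by
  by_contra hT
  have hT' : rank H.terminal + 2 = m + n := by
    have := rank_inv H.terminal
    omega
  have hfree : ∀ σ : Square m n, rank σ + 3 ≤ m + n → σ ∉ H.terminalDiagonal := by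
    intro σ hσ h
    rcases sameClass_of_mem_diagonal h with h | h <;> omega
  have hpath : ∀ {σ τ : Square m n}, ReflTransGen H.Edge σ τ → H.FreePath σ τ := by
    intro σ τ h
    refine ReflTransGen.mono (fun x y hxy => ⟨hxy, hfree x ?_⟩) _ _ h
    by_contra hx
    apply hxy.ne_terminal hH
    have := x.1.isLt
    have := x.2.isLt
    have := H.terminal.1.isLt
    have := H.terminal.2.isLt
    unfold rank at *
    apply Square.ext_val <;> omega
  -- The stretch from `inv x` to `y` reverses to one from `inv y` to `x`, so the crossing at `y`
  -- would lead back to `x`.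
  have key : ∀ {x y : Square m n}, H.Edge x (ProjBoard.inv x) → H.Edge y (ProjBoard.inv y) →
      ¬ TransGen H.Edge x y := by
    intro x y hx hy h
    obtain ⟨z, hz, hzy⟩ := TransGen.head'_iff.1 h
    rw [hz.right_unique hH hx] at hzy
    have h₁ := ((hpath hzy).inv (by omega) hmn hH).reflTransGen
    rw [inv_inv] at h₁
    exact hH.acyclic ((TransGen.head' hy h₁).trans h)
  -- The ends of the subdiagonals of ranks `m + n - 3` and `m + n - 4` provide two distinct
  -- crossings.
  let x₁ : Square m n := (⟨m - 1, by omega⟩, ⟨n - 2, by omega⟩)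
  let y₁ : Square m n := (⟨m - 2, by omega⟩, ⟨n - 1, by omega⟩)
  let x₂ : Square m n := (⟨m - 1, by omega⟩, ⟨n - 3, by omega⟩)
  let y₂ : Square m n := (⟨m - 3, by omega⟩, ⟨n - 1, by omega⟩)
  have hx₁ : rank x₁ = m - 1 + (n - 2) := rfl
  have hy₁ : rank y₁ = m - 2 + (n - 1) := rfl
  have hx₂ : rank x₂ = m - 1 + (n - 3) := rfl
  have hy₂ : rank y₂ = m - 3 + (n - 1) := rfl
  have hm : m - 1 + 1 = m := by omega
  have hn' : n - 1 + 1 = n := by omega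
  obtain ⟨u, hu, hu'⟩ := exists_edge_inv (σ := x₁) (τ := y₁) hmn hH (by omega)
    (hfree _ (by omega)) hm hn'
  obtain ⟨v, hv, hv'⟩ := exists_edge_inv (σ := x₂) (τ := y₂) hmn hH (by omega)
    (hfree _ (by omega)) hm hn'
  have huv : u ≠ v := by
    rintro rfl
    omega
  rcases hH.transGen_or huv with h | h
  · exact key hu' hv' h
  · exact key hv' hu' h

/-! ### Paths around the terminal diagonal -/

theorem inverse_start_eq_iff {σ : Square m n} :
    H.inverse.start = σ ↔ H.terminal = ProjBoard.inv σ := by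
  change ProjBoard.inv H.terminal = σ ↔ _
  constructor
  · rintro rfl
    rw [inv_inv]
  · intro h
    rw [h, inv_inv]

/-- The terminal diagonal of the path is `S_a ∪ S_b`. -/
structure IsTerminalPair (H : Walk m n) (a b : ℕ) : Prop where
  le : a ≤ b
  add : a + b + 3 = m + n
  mem_iff : ∀ σ, σ ∈ H.terminalDiagonal ↔ rank σ = a ∨ rank σ = b

variable {a b : ℕ}

/-- A path that leaves `S_b` for `S_{b+1}` crosses the boundary. -/
theorem outer_freePath (hn : 2 ≤ n) (hmn : n ≤ m) (hH : H.IsHamiltonianPath)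
    (hT : H.IsTerminalPair a b) {σ : Square m n} (hσ : rank σ = b + 1) :
    H.FreePath σ (inv σ) := by
  have hab := hT.le
  have hadd := hT.add
  -- A single path is followed, up to rank `m + n - 2`. Without an earlier crossing it ends at the
  -- northeastern corner, where both directions cross.
  rcases hH.run hn hmn (σ := σ) (τ := σ) rfl (m + n - 2 - (b + 1))
    (fun υ h₁ h₂ => by rw [hT.mem_iff]; omega) with h | h | h
  · exact h
  · exact h
  obtain ⟨e, v, hd, σ', -, hp, -, h₁, h₂, -, -⟩ := h
  have h₃ := σ'.1.isLt
  have h₄ := σ'.2.isLt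
  have hfree : σ' ∉ H.terminalDiagonal := by
    rw [hT.mem_iff]
    unfold rank at *
    omega
  refine hp.to_inv hn hmn hH ⟨?_, hfree⟩
  have hE : east σ' = inv σ' := east_of_last (by unfold rank at *; omega)
  have hN : north σ' = inv σ' := north_of_last (by unfold rank at *; omega)
  rcases hH.exists_succ (IsHamiltonianPath.ne_terminal_of_notMem hfree) with h | h
  · rwa [hE] at h
  · rwa [hN] at h

/-- Off the last column, a step north from `inv (east P)` to `east P` would close the outer path
into a cycle; so `east P` is entered from `P` and `inv (east P)` goes on to `inv P`. In the last
column `east P = inv P`, which is reached directly or through the outer path from `north P`. -/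
theorem transGen_of_southeast (hn : 2 ≤ n) (hmn : n ≤ m) (hH : H.IsHamiltonianPath)
    (hT : H.IsTerminalPair a b) {P : Square m n} (hP : rank P = b)
    (hSE : P.1.val + 1 = m ∨ P.2.val = 0) (hs : H.start ≠ east P)
    (ht : H.inverse.start ≠ east P) : TransGen H.Edge P (inv P) := by
  have hab := hT.le
  have hadd := hT.add
  rw [ne_eq, inverse_start_eq_iff] at ht
  by_cases hm : P.1.val + 1 < m
  · obtain ⟨e₁, e₂⟩ := east_of_lt hm
    have hr : rank (east P) = b + 1 := by
      unfold rank at *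
      omega
    have hout := (outer_freePath hn hmn hH hT hr).reflTransGen
    have hN : north (inv (east P)) = east P := by
      rw [north_of_last, inv_inv]
      rw [inv_snd]
      omega
    have hcyc : ¬ H.Edge (inv (east P)) (east P) := fun h =>
      hH.acyclic (TransGen.tail' hout h)
    have hP' : H.Edge P (east P) :=
      (hH.pred_of_east_eq_north hN.symm (Ne.symm hs)).resolve_right hcyc
    rcases hH.exists_succ (Ne.symm ht) with h | h
    · rw [east_inv_east] at h
      exact TransGen.tail' (ReflTransGen.head hP' hout) h
    · rw [hN] at h
      exact absurd h hcyc
  · have hE : east P = inv P := east_of_last hm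
    rw [hE] at hs ht
    rw [inv_inv] at ht
    rcases hH.exists_succ (Ne.symm ht) with h | h
    · rw [hE] at h
      exact TransGen.single h
    · have hlt : P.2.val + 1 < n := by
        have := P.1.isLt
        unfold rank at hP
        omega
      obtain ⟨e₁, e₂⟩ := north_of_lt hlt
      have hr : rank (north P) = b + 1 := by
        unfold rank at *
        omega
      have hout := (outer_freePath hn hmn hH hT hr).reflTransGen
      have heq : east P = north (inv (north P)) := by
        rw [north_inv_north, hE]
      rcases hH.pred_of_east_eq_north heq (by rw [hE]; exact Ne.symm hs) with h' | h'
      · rw [hE] at h'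
        exact TransGen.single h'
      · rw [hE] at h'
        exact TransGen.tail' (ReflTransGen.head h hout) h'

theorem transGen_of_northwest (hn : 2 ≤ n) (hmn : n ≤ m) (hH : H.IsHamiltonianPath)
    (hT : H.IsTerminalPair a b) {B : Square m n} (hB : rank B = b) (hNW : B.2.val + 1 = n)
    (hs : H.start ≠ inv B) (ht : H.inverse.start ≠ inv B) : TransGen H.Edge B (inv B) := by
  have hab := hT.le
  have hadd := hT.add
  rw [ne_eq, inverse_start_eq_iff, inv_inv] at ht
  have hN : north B = inv B := north_of_last (by omega)
  have hlt : B.1.val + 1 < m := by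
    unfold rank at hB
    omega
  rcases hH.exists_succ (Ne.symm ht) with h | h
  · obtain ⟨e₁, e₂⟩ := east_of_lt hlt
    have hr : rank (east B) = b + 1 := by
      unfold rank at *
      omega
    have hout := (outer_freePath hn hmn hH hT hr).reflTransGen
    have heq : east (inv (east B)) = north B := by
      rw [east_inv_east, hN]
    rcases hH.pred_of_east_eq_north heq (by rw [east_inv_east]; exact Ne.symm hs) with h' | h'
    · rw [east_inv_east] at h'
      exact TransGen.tail' (ReflTransGen.head h hout) h'
    · rw [east_inv_east] at h'
      exact TransGen.single h'
  · rw [hN] at h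
    exact TransGen.single h

/-- The southeasternmost square `P` and the northwesternmost square `B` of `S_b` do not both precede
their inverses. -/
theorem not_transGen_corners (hn : 2 ≤ n) (hmn : n ≤ m) (hH : H.IsHamiltonianPath)
    (hT : H.IsTerminalPair a b) {P B : Square m n} (hP : rank P = b)
    (hSE : P.1.val + 1 = m ∨ P.2.val = 0) (hB : rank B = b) (hNW : B.2.val + 1 = n)
    (hPP : TransGen H.Edge P (inv P)) : ¬ TransGen H.Edge B (inv B) := by
  intro hBB
  have hab := hT.le
  have hadd := hT.add
  have hP' := rank_inv P
  have hB' := rank_inv B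
  rcases hab.eq_or_lt with hab | hab
  · have hr : rank (inv P) = b + 1 := by omega
    have := (outer_freePath hn hmn hH hT hr).reflTransGen
    rw [inv_inv] at this
    exact hH.acyclic (hPP.trans_left this)
  · rcases hH.run hn hmn (σ := inv P) (τ := inv B) (by omega) (b - (a + 1))
      (fun υ h₁ h₂ => by rw [hT.mem_iff]; omega) with h | h | h
    · have := h.reflTransGen
      rw [inv_inv] at this
      exact hH.acyclic (hPP.trans_left this)
    · have := h.reflTransGen
      rw [inv_inv] at this
      exact hH.acyclic (hBB.trans_left this)
    obtain ⟨e, v, hd, σ', τ', hσ, hτ, h₁, h₂, h₃, h₄⟩ := h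
    have h₅ := P.1.isLt
    have h₆ := P.2.isLt
    have h₇ := B.1.isLt
    have h₈ := σ'.1.isLt
    have h₉ := σ'.2.isLt
    have h₁₀ := τ'.1.isLt
    have h₁₁ := τ'.2.isLt
    rw [inv_fst] at h₁ h₃
    rw [inv_snd] at h₂ h₄
    -- `τ' - σ' = P - B`, and both squares lie on `S_b`; since `B` and `P` are its extreme squares,
    -- only one position fits.
    have e₁ : σ' = B := by
      unfold rank at *
      apply Square.ext_val <;> omega
    have e₂ : τ' = P := by
      unfold rank at *
      apply Square.ext_val <;> omega
    subst e₁ e₂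
    exact hH.acyclic (((hPP.trans_left hσ.reflTransGen).trans hBB).trans_left hτ.reflTransGen)

/-! ### An inner diagonal that travels north -/

/-- The path from a northwestern end `t` is forced across the boundary by the northward diagonal, so
it reaches `inv t`. Either `t = inv P`, or an eastward diagonal farther out sends `inv t` back to
`t`, a cycle. -/
theorem freePath_of_inner_north (hn : 2 ≤ n) (hmn : n ≤ m) (hH : H.IsHamiltonianPath)
    (hT : H.IsTerminalPair a b) {P : Square m n} (hP : rank P = b)
    (hSE : P.1.val + 1 = m ∨ P.2.val = 0) {i : ℕ} (hai : a < i) (him : i + i + 3 ≤ m + n)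
    (hN : ∀ σ : Square m n, rank σ = i ∨ rank σ + i + 3 = m + n → H.Edge σ (north σ))
    (hE : ∀ k, a < k → k < i → ∀ σ : Square m n, rank σ + k + 3 = m + n → H.Edge σ (east σ)) :
    H.FreePath (inv P) P := by
  have hab := hT.le
  have hadd := hT.add
  have hP' := rank_inv P
  have hP₁ := P.1.isLt
  have hP₂ := P.2.isLt
  by_cases hin : i + 2 ≤ n
  · let t : Square m n := (⟨0, by omega⟩, ⟨i, by omega⟩)
    -- An auxiliary companion of `north t` at the other end of `S_{i+1}`: it cannot reach `inv w`,
    -- whose step north returns to `w`. If neither path crosses, the room left to `w` in the east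
    -- bounds `e` and so forces `σ'` into the northern row.
    let w : Square m n := (⟨i + 1, by omega⟩, ⟨0, by omega⟩)
    have ht₁ : t.1.val = 0 := rfl
    have ht₂ : t.2.val = i := rfl
    have hw₁ : w.1.val = i + 1 := rfl
    have hw₂ : w.2.val = 0 := rfl
    have htr : rank t = i := Nat.zero_add i
    have hwr : rank w = i + 1 := rfl
    have hw' := rank_inv w
    obtain ⟨e₁, e₂⟩ := north_of_lt (σ := t) (by omega)
    have htr' : rank (north t) = i + 1 := by
      unfold rank
      omega
    have htN : H.FreeEdge t (north t) :=
      ⟨hN t (Or.inl htr), by rw [hT.mem_iff]; omega⟩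
    have htt : H.FreePath t (inv t) := by
      rcases hH.run hn hmn (σ := north t) (τ := w) (by omega) (m + n - 3 - i - (i + 1))
        (fun υ h₁ h₂ => by rw [hT.mem_iff]; omega) with h | h | h
      · exact (ReflTransGen.head htN h).tail (htN.inv hn hmn hH)
      · have h' := hN (inv w) (by omega)
        rw [north_of_last (by rw [inv_snd]; omega), inv_inv] at h'
        exact absurd (TransGen.tail' h.reflTransGen h') hH.acyclic
      · obtain ⟨e, v, hd, σ', τ', hσ, -, h₁, h₂, h₃, h₄⟩ := h
        have h₅ := τ'.1.isLt
        have h₆ := σ'.2.isLt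
        have hr : rank σ' + i + 3 = m + n := by
          unfold rank
          omega
        have h' := hN σ' (Or.inr hr)
        rw [north_of_last (by omega)] at h'
        refine FreePath.to_inv hn hmn hH (ReflTransGen.head htN hσ) ⟨h', ?_⟩
        rw [hT.mem_iff]
        omega
    rcases Nat.lt_or_ge (a + 1) i with h | h
    · have ht' := rank_inv t
      have h' := hE (i - 1) (by omega) (by omega) (inv t) (by omega)
      rw [east_of_last (by rw [inv_fst]; omega), inv_inv] at h'
      exact absurd (TransGen.tail' htt.reflTransGen h') hH.acyclic
    · have : t = inv P := by
        unfold rank at *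
        apply Square.ext_val
        · rw [inv_fst]
          omega
        · rw [inv_snd]
          omega
      rw [this, inv_inv] at htt
      exact htt
  -- The first rank beyond `a` whose subdiagonal has a square in the northern row. From that square,
  -- a path that does not cross stays in this row until `S_i` sends it north.
  · obtain ⟨g, hg⟩ : ∃ g, max (a + 1) (n - 1) = g := ⟨_, rfl⟩
    let t : Square m n := (⟨g - (n - 1), by omega⟩, ⟨n - 1, by omega⟩)
    have ht₁ : t.1.val = g - (n - 1) := rfl
    have ht₂ : t.2.val = n - 1 := rfl
    have htr : rank t = g := by
      unfold rank
      omega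
    have htt : H.FreePath t (inv t) := by
      rcases hH.run hn hmn (σ := t) (τ := t) rfl (i - g)
        (fun υ h₁ h₂ => by rw [hT.mem_iff]; omega) with h | h | h
      · exact h
      · exact h
      · obtain ⟨e, v, hd, σ', τ', hσ, -, h₁, h₂, h₃, h₄⟩ := h
        have h₆ := σ'.2.isLt
        have hr : rank σ' = i := by
          unfold rank
          omega
        have h' := hN σ' (Or.inl hr)
        rw [north_of_last (by omega)] at h'
        refine hσ.to_inv hn hmn hH ⟨h', ?_⟩
        rw [hT.mem_iff]
        omega
    rcases Nat.lt_or_ge (a + 1) (n - 1) with h | h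
    · have ht' := rank_inv t
      have h' := hE (n - 2) (by omega) (by omega) (inv t) (by omega)
      rw [east_of_last (by rw [inv_fst]; omega), inv_inv] at h'
      exact absurd (TransGen.tail' htt.reflTransGen h') hH.acyclic
    · have : t = inv P := by
        unfold rank at *
        apply Square.ext_val
        · rw [inv_fst]
          omega
        · rw [inv_snd]
          omega
      rw [this, inv_inv] at htt
      exact htt

theorem travelsEast_of_isInnerDiagonal (hn : 2 ≤ n) (hmn : n ≤ m) (hH : H.IsHamiltonianPath)
    (hT : H.IsTerminalPair a b) {P : Square m n} (hP : rank P = b)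
    (hSE : P.1.val + 1 = m ∨ P.2.val = 0) (hPP : TransGen H.Edge P (inv P))
    (D : Set (Square m n)) (hD : IsInnerDiagonal a D) : H.TravelsEast D := by
  classical
  have hab := hT.le
  have hadd := hT.add
  by_contra hnot
  -- The least such `i` is taken, so that all inner diagonals farther out travel east.
  let Q : ℕ → Prop := fun i => a < i ∧ i + i + 3 ≤ m + n ∧
    ∃ σ : Square m n, (rank σ = i ∨ rank σ + i + 3 = m + n) ∧ ¬ H.Edge σ (east σ)
  have hQ : ∃ i, Q i := by
    obtain ⟨-, i, j, hij, hadd', rfl, hai⟩ := hD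
    unfold TravelsEast at hnot
    push Not at hnot
    obtain ⟨σ, hσ, hσ'⟩ := hnot
    refine ⟨i, hai, by omega, σ, ?_, hσ'⟩
    rcases hσ with hσ | hσ
    · exact Or.inl hσ
    · have : rank σ = j := hσ
      omega
  obtain ⟨hai, him, σ, hσ, hσ'⟩ := Nat.find_spec hQ
  have hmin := fun k (hk : k < Nat.find hQ) => Nat.find_min hQ hk
  revert hai him hσ hmin
  generalize Nat.find hQ = i
  intro hai him hσ hmin
  have hfree : σ ∉ H.terminalDiagonal := by
    rw [hT.mem_iff]
    omega
  have hσN := (hH.exists_succ (IsHamiltonianPath.ne_terminal_of_notMem hfree)).resolve_left hσ'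
  have h := freePath_of_inner_north hn hmn hH hT hP hSE hai him
    (fun τ hτ => (hH.edge_iff_of_mem_diagonal hfree ((mem_diagonal_iff hn hmn).2 (by
      unfold SameClass
      omega))).2.1 hσN)
    (fun k hk hki τ hτ => by
      by_contra h
      exact hmin k hki ⟨hk, by omega, τ, Or.inr hτ, h⟩)
  exact hH.acyclic (hPP.trans_left h.reflTransGen)

/-! ### The terminal pair, the southeastern end, and the conclusion -/

theorem IsHamiltonianPath.exists_isTerminalPair (hn : 3 ≤ n) (hmn : n ≤ m)
    (hH : H.IsHamiltonianPath) : ∃ a b, H.IsTerminalPair a b := by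
  have h := hH.rank_terminal hn hmn
  have hmem : ∀ σ, σ ∈ H.terminalDiagonal ↔
      rank σ = rank H.terminal ∨ rank σ + rank H.terminal + 3 = m + n :=
    fun σ => mem_diagonal_iff (by omega) hmn
  rcases le_total (rank H.terminal) (m + n - 3 - rank H.terminal) with h' | h'
  · exact ⟨_, _, h', by omega, fun σ => by rw [hmem]; omega⟩
  · exact ⟨_, _, h', by omega, fun σ => by rw [hmem]; omega⟩

end Walk

theorem exists_isSoutheasternmost {b : ℕ} (hm : 0 < m) (hn : 0 < n) (hb : b + 2 ≤ m + n) :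
    ∃ P : Square m n, rank P = b ∧ (P.1.val + 1 = m ∨ P.2.val = 0) ∧
      IsSoutheasternmost P (subdiagonal m n b) := by
  by_cases hbm : b < m
  · refine ⟨(⟨b, hbm⟩, ⟨0, hn⟩), rfl, Or.inr rfl, rfl, fun σ hσ => ?_⟩
    have : σ.1.val + σ.2.val = b := hσ
    simp only [Fin.le_def]
    omega
  · have hr : m - 1 + (b - (m - 1)) = b := by omega
    refine ⟨(⟨m - 1, by omega⟩, ⟨b - (m - 1), by omega⟩), hr, Or.inl (Nat.sub_add_cancel hm), hr,
      fun σ hσ => ?_⟩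
    have : σ.1.val + σ.2.val = b := hσ
    have := σ.1.isLt
    simp only [Fin.le_def]
    omega

end ProjBoard

theorem mainTheorem6 (m n : ℕ) (hn : 3 ≤ n) (hmn : n ≤ m)
    (H : ProjBoard.Walk m n) (hH : H.IsHamiltonianPath) :
    ∃ (a b : ℕ) (τ : ProjBoard.Square m n),
      a ≤ b ∧ a + b + 3 = m + n ∧
      H.terminalDiagonal = ProjBoard.subdiagonal m n a ∪ ProjBoard.subdiagonal m n b ∧
      ProjBoard.IsSoutheasternmost τ (ProjBoard.subdiagonal m n b) ∧
      ((H.start = ProjBoard.east τ ∨ H.inverse.start = ProjBoard.east τ) ∨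
        ((∀ D : Set (ProjBoard.Square m n), ProjBoard.IsInnerDiagonal a D → H.TravelsEast D) ∧
          ∃ ι : ProjBoard.Square m n, (ι = H.start ∨ ι = H.inverse.start) ∧
            ι.2.val = 0 ∧ 1 ≤ ι.1.val ∧ ι.1.val ≤ (m + n) / 2 - 1)) := by
  obtain ⟨a, b, hT⟩ := hH.exists_isTerminalPair hn hmn
  have hab := hT.le
  have hadd := hT.add
  obtain ⟨P, hP, hSE, hP'⟩ := ProjBoard.exists_isSoutheasternmost (m := m) (n := n) (b := b)
    (by omega) (by omega) (by omega)
  refine ⟨a, b, P, hab, hadd, Set.ext fun σ => hT.mem_iff σ, hP', or_iff_not_imp_left.2 ?_⟩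
  intro h
  push Not at h
  have hn' : 2 ≤ n := by omega
  have hPP := ProjBoard.Walk.transGen_of_southeast hn' hmn hH hT hP hSE h.1 h.2
  refine ⟨ProjBoard.Walk.travelsEast_of_isInnerDiagonal hn' hmn hH hT hP hSE hPP, ?_⟩
  let B : ProjBoard.Square m n := (⟨m - 2 - a, by omega⟩, ⟨n - 1, by omega⟩)
  have hB₁ : B.1.val = m - 2 - a := rfl
  have hB₂ : B.2.val = n - 1 := rfl
  have hB : ProjBoard.rank B = b := by
    unfold ProjBoard.rank
    omega
  -- Strictness gives the upper bound on `a + 1`, the column of `inv B`. If `a = b`, then `inv P` is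
  -- on `S_{b+1}` and the outer path leads back to `P`.
  have hlt : a < b := by
    by_contra hab'
    have hPi := ProjBoard.rank_inv P
    have := (ProjBoard.Walk.outer_freePath hn' hmn hH hT
      (show ProjBoard.rank (ProjBoard.inv P) = b + 1 by omega)).reflTransGen
    rw [ProjBoard.inv_inv] at this
    exact hH.acyclic (hPP.trans_left this)
  refine ⟨ProjBoard.inv B, ?_, ?_, ?_, ?_⟩
  · by_contra h'
    push Not at h'
    exact ProjBoard.Walk.not_transGen_corners hn' hmn hH hT hP hSE hB (by omega) hPP
      (ProjBoard.Walk.transGen_of_northwest hn' hmn hH hT hB (by omega) h'.1.symm h'.2.symm)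
  · rw [ProjBoard.inv_snd]
    omega
  · rw [ProjBoard.inv_fst]
    omega
  · rw [ProjBoard.inv_fst]
    omega
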